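/- Let $q>1$ and $n>1$ be integers. A periodic sequence $S=(s_i)_{i\in\mathbb Z}$ with terms in $\mathbb Z_q$ and (least) period $m$ is called an orientable sequence of order $n$, or an $\mathcal{OS}_q(n)$, if, writing $\mathbf s_n(i)=(s_i,s_{i+1},\dots,s_{i+n-1})$, - $\mathbf s_n(i)=\mathbf s_n(j)$ implies $i\equiv j\pmod m$, and - $\mathbf s_n(i)\ne\mathbf s_n(j)^R$ for all $i,j$, where $(u_0,\dots,u_{n-1})^R=(u_{n-1},\dots,u_0)$. A run of $0$ of length $t\ge 1$ in $S$ is a string $s_j=\dots=s_{j+t-1}=0$ with $s_{j-1}\neq 0$ and $s_{j+t}\ne0$. An $\mathcal{OS}_q(n)$ is called good if every run of $0$ in it has length at most $n-2$. **Theorem.** Let $q>2$. For every integer $s\ge 0$ there exist - a good $\mathcal{OS}_q(2s+3)$ of period at least $q^{2s+1}m_2+\dfrac{q^{2s+1}-1}{q-1}$, and - a good $\mathcal{OS}_q(2s+4)$ of period at least $q^{2s+1}m_3+\dfrac{q^{2s+1}-1}{q-1}$, where $$m_2=\begin{cases}\frac{(q-1)(q-2)}{2}-1 & \text{if } q\ne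 6,\\[2pt] \frac{(q-1)(q-2)}{2}-2 & \text{if } q=6,\end{cases}$$ and $$m_3=\begin{cases}\frac{(q-1)^3}{2}-1 & \text{if } q \text{ is odd},\\[2pt] \frac12\left((q-1)^3-\frac{3q^2-6q+4}{4}\right)-1 & \text{if } q \text{ is even and } q\neq 6,\\[2pt] \frac12\left((q-1)^3-\frac{3q^2-6q+4}{4}\right)-2 & \text{if } q=6.\end{cases}$$ -/

import Mathlib

namespace Orientable

/-- The `n`-tuple `(s_i, s_{i+1}, …, s_{i+n-1})` of a sequence over `ℤ_q`. -/
def window {q : ℕ} (n : ℕ) (S : ℤ → ZMod q) (i : ℤ) : Fin n → ZMod q :=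
  fun k => S (i + ((k : ℕ) : ℤ))

/-- The reverse `(u_{n-1}, …, u_0)` of an `n`-tuple. -/
def reverse {q n : ℕ} (u : Fin n → ZMod q) : Fin n → ZMod q :=
  fun k => u k.rev

/-- `m` is the period of the sequence: the least positive integer `p` with `s_{i+p} = s_i`
for all `i`. -/
def HasPeriod {q : ℕ} (S : ℤ → ZMod q) (m : ℕ) : Prop :=
  IsLeast {p : ℕ | 0 < p ∧ Function.Periodic S (p : ℤ)} m

/-- `S` is a `q`-ary `n`-window sequence (`q > 1`, `n > 1`) of period `m`: no `n`-tuple appears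
more than once in a period. -/
structure IsWindowSequence (q n m : ℕ) (S : ℤ → ZMod q) : Prop where
  one_lt_alphabet : 1 < q
  one_lt_order : 1 < n
  hasPeriod : HasPeriod S m
  window_unique : ∀ i j : ℤ, window n S i = window n S j → i ≡ j [ZMOD (m : ℤ)]

/-- `S` is an orientable sequence of order `n` (an `OS_q(n)`) of period `m`. -/
structure IsOrientable (q n m : ℕ) (S : ℤ → ZMod q) : Prop
    extends IsWindowSequence q n m S where
  window_ne_reverse : ∀ i j : ℤ, window n S i ≠ reverse (window n S j)

/-- `s_j, …, s_{j+t-1}` is a (nonempty) run of `a` in `S`, of length `t`. -/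
structure IsRun {q : ℕ} (S : ℤ → ZMod q) (a : ZMod q) (j : ℤ) (t : ℕ) : Prop where
  length_pos : 0 < t
  eq_on : ∀ k : ℕ, k < t → S (j + (k : ℤ)) = a
  ne_before : S (j - 1) ≠ a
  ne_after : S (j + (t : ℤ)) ≠ a

/-- `S` is a good orientable sequence of order `n` and period `m`: every run of `0` has length
at most `n - 2` (written without truncated subtraction). -/
structure IsGoodOrientable (q n m : ℕ) (S : ℤ → ZMod q) : Prop
    extends IsOrientable q n m S where
  run_zero_le : ∀ (j : ℤ) (t : ℕ), IsRun S 0 j t → t + 2 ≤ n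

/-- The number `m_2`. -/
def m₂ (q : ℕ) : ℚ :=
  if q = 6 then ((q : ℚ) - 1) * ((q : ℚ) - 2) / 2 - 2
  else ((q : ℚ) - 1) * ((q : ℚ) - 2) / 2 - 1

/-- The number `m_3`. -/
def m₃ (q : ℕ) : ℚ :=
  if Odd q then ((q : ℚ) - 1) ^ 3 / 2 - 1
  else if q = 6 then
    (((q : ℚ) - 1) ^ 3 - (3 * (q : ℚ) ^ 2 - 6 * (q : ℚ) + 4) / 4) / 2 - 2
  else
    (((q : ℚ) - 1) ^ 3 - (3 * (q : ℚ) ^ 2 - 6 * (q : ℚ) + 4) / 4) / 2 - 1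

end Orientable

/-!
Call a sequence negative orientable if no window is the negated reverse of a window. Passing to
an antiderivative turns an orientable sequence of order `n` into a negative orientable one of
order `n + 1` and conversely, since differences turn reversal into negated reversal. If the sum
`w` of the terms in a period `m` is a unit modulo `q`, then the antiderivative has period `q m`.
Its sum `W` over a period satisfies `2 W = 0`; inserting the term `a = 1 - W` next to a longest
run of `a` makes the sum equal to `1`, so the process can go on with period `q m + 1`
(`IsExtendable.exists_succ`). The insertion keeps the property in question
(`isExtendable_insertTerm`) because the lengthened run occurs nowhere else and its
neighbours `x`, `y` satisfy `x ≠ y` in the orientable case, and `a ≠ -a` in the other one.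
Runs of `0` get longer by one in each step, like the order, so the sequences stay good.

The recursion starts from negative orientable sequences of order `2` and `3` without zeros. Give
the nonzero letters integer weights, odd under negation. The words of positive weight then contain
no word together with its negated reverse. They are closed under rotation, which makes the graph
whose edges they are a union of cycles, and they are connected, because letters may be raised to
the one of largest weight. So there is a closed Euler trail, that is, a sequence whose windows are
exactly these words (`exists_sequence_of_connected`). Omitting at most one constant word, one
makes the sum of the terms a unit (`exists_isUnit_sub`), except for `q = 4` and `q = 6` in order
`2`, where short explicit sequences are used. The weights are chosen so that only few words have
weight zero, namely at most `q - 1` of length `2`, and of length `3` none if `q` is odd and at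
most `3 q - 5` if `q` is even; this gives the lengths `m₂` and `m₃`.
-/

namespace Orientable

/-! ### Sums over a period -/

lemma sum_range_add_int_of_periodic {G : Type*} [AddCommGroup G] {f : ℤ → G} {m : ℕ}
    (hf : Function.Periodic f (m : ℤ)) (c : ℤ) :
    ∑ i ∈ Finset.range m, f ((i : ℤ) + c) = ∑ i ∈ Finset.range m, f (i : ℤ) := by
  have step : ∀ c : ℤ, ∑ i ∈ Finset.range m, f ((i : ℤ) + (c + 1))
      = ∑ i ∈ Finset.range m, f ((i : ℤ) + c) := by
    intro c
    have h1 := Finset.sum_range_succ (fun i : ℕ => f ((i : ℤ) + c)) m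
    have h2 := Finset.sum_range_succ' (fun i : ℕ => f ((i : ℤ) + c)) m
    have h3 : f ((m : ℤ) + c) = f (((0 : ℕ) : ℤ) + c) := by
      rw [add_comm, hf]; simp
    rw [h2, ← h3] at h1
    have h4 := add_right_cancel h1
    rw [← h4]
    refine Finset.sum_congr rfl fun i _ => ?_
    congr 1; push_cast; ring
  induction c using Int.induction_on with
  | zero => simp
  | succ k ih => rw [step, ih]
  | pred k ih => rw [← ih, ← step]; simp

/-- A discrete antiderivative of a bi-infinite sequence. -/
lemma exists_antiderivative {G : Type*} [AddCommGroup G] (T : ℤ → G) :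
    ∃ S : ℤ → G, ∀ i, S (i + 1) = S i + T i := by
  refine ⟨fun i => ∑ j ∈ Finset.range i.toNat, T (j : ℤ)
    - ∑ j ∈ Finset.range (-i).toNat, T (-((j : ℤ) + 1)), fun i => ?_⟩
  rcases le_or_gt 0 i with h | h
  · obtain ⟨k, rfl⟩ := Int.eq_ofNat_of_zero_le h
    have h1 : ((k : ℤ) + 1).toNat = k + 1 := by omega
    have h2 : (-((k : ℤ) + 1)).toNat = 0 := by omega
    have h3 : (-(k : ℤ)).toNat = 0 := by omega
    simp only [h1, h2, h3, Finset.sum_range_succ, Finset.sum_range_zero, Int.toNat_natCast,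
      sub_zero]
  · obtain ⟨k, rfl⟩ : ∃ k : ℕ, i = -((k : ℤ) + 1) := ⟨(-i - 1).toNat, by omega⟩
    have h1 : (-((k : ℤ) + 1) + 1).toNat = 0 := by omega
    have h2 : (-(-((k : ℤ) + 1) + 1)).toNat = k := by omega
    have h3 : (-((k : ℤ) + 1)).toNat = 0 := by omega
    have h4 : (-(-((k : ℤ) + 1))).toNat = k + 1 := by omega
    simp only [h1, h2, h3, h4, Finset.sum_range_succ]
    simp

lemma antiderivative_add_period {G : Type*} [AddCommGroup G] {S T : ℤ → G} {m : ℕ}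
    (hT : Function.Periodic T (m : ℤ)) (hS : ∀ i, S (i + 1) = S i + T i) (i : ℤ) :
    S (i + m) = S i + ∑ j ∈ Finset.range m, T j := by
  have h0 : ∀ k : ℕ, S (i + k) = S i + ∑ j ∈ Finset.range k, T ((j : ℤ) + i) := by
    intro k
    induction k with
    | zero => simp
    | succ k ih =>
      rw [Finset.sum_range_succ, ← add_assoc, ← ih, add_comm (k : ℤ) i, ← hS]
      push_cast; ring_nf
  rw [h0, sum_range_add_int_of_periodic hT]

/-! ### Inserting one term into a longest constant run -/

/-- The sequence of period `m + 1` which agrees with `S` on `[0, m)` and takes the value `a`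
at `m`. -/
def insertTerm {α : Type*} (S : ℤ → α) (m : ℕ) (a : α) : ℤ → α :=
  fun i => if i % ((m : ℤ) + 1) < m then S (i % ((m : ℤ) + 1)) else a

section Insert

variable {α : Type*} {S : ℤ → α} {m r : ℕ} {a : α}

lemma insertTerm_periodic (S : ℤ → α) (m : ℕ) (a : α) :
    Function.Periodic (insertTerm S m a) ((m : ℤ) + 1) := by
  intro i
  simp [insertTerm]

lemma insertTerm_congr {i j : ℤ} (h : i ≡ j [ZMOD (m : ℤ) + 1]) :
    insertTerm S m a i = insertTerm S m a j := by
  unfold insertTerm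
  rw [h]

lemma insertTerm_of_lt {i : ℤ} (h0 : 0 ≤ i) (h1 : i < m) : insertTerm S m a i = S i := by
  have : i % ((m : ℤ) + 1) = i := Int.emod_eq_of_lt h0 (by omega)
  simp [insertTerm, this, h1]

lemma insertTerm_self : insertTerm S m a m = a := by
  have : (m : ℤ) % ((m : ℤ) + 1) = m := Int.emod_eq_of_lt (by omega) (by omega)
  simp [insertTerm, this]

/-- `S` has period `m`, its term at `-r-1` differs from `a`, and its terms at `-r, …, -1` are
all equal to `a`. -/
structure EndsWithRun (S : ℤ → α) (m r : ℕ) (a : α) : Prop where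
  periodic : Function.Periodic S (m : ℤ)
  before_ne : S (-(r : ℤ) - 1) ≠ a
  eq_on : ∀ i : ℤ, -(r : ℤ) ≤ i → i < 0 → S i = a

namespace EndsWithRun

lemma lt_period (h : EndsWithRun S m r a) (hm : 0 < m) : r < m := by
  by_contra hc
  apply h.before_ne
  rw [← h.periodic]
  exact h.eq_on _ (by omega) (by omega)

/-- Away from the inserted term, the sequence is unchanged. -/
lemma insertTerm_eq (h : EndsWithRun S m r a) (hm : 0 < m) {i : ℤ} (h0 : -(r : ℤ) ≤ i)
    (h1 : i < m) : insertTerm S m a i = S i := by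
  have hr := h.lt_period hm
  rcases le_or_gt 0 i with h2 | h2
  · exact insertTerm_of_lt h2 h1
  rw [h.eq_on i h0 h2, ← insertTerm_periodic S m a]
  rcases eq_or_ne i (-1) with h3 | h3
  · rw [show i + ((m : ℤ) + 1) = m by omega, insertTerm_self]
  · rw [insertTerm_of_lt (by omega) (by omega), show i + ((m : ℤ) + 1) = i + 1 + m by omega,
      h.periodic, h.eq_on _ (by omega) (by omega)]

lemma insertTerm_eq_run (h : EndsWithRun S m r a) (hm : 0 < m) {i : ℤ}
    (h0 : -(r : ℤ) - 1 ≤ i) (h1 : i < 0) : insertTerm S m a i = a := by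
  have hr := h.lt_period hm
  rcases eq_or_ne i (-(r : ℤ) - 1) with h2 | h2
  · rw [← insertTerm_periodic S m a]
    rcases Nat.eq_zero_or_pos r with h3 | h3
    · rw [show i + ((m : ℤ) + 1) = m by omega, insertTerm_self]
    · rw [insertTerm_of_lt (by omega) (by omega), show i + ((m : ℤ) + 1) = -r + m by omega,
        h.periodic, h.eq_on _ (by omega) (by omega)]
  · rw [h.insertTerm_eq hm (by omega) (by omega), h.eq_on _ (by omega) h1]

lemma insertTerm_before (h : EndsWithRun S m r a) (hm : 0 < m) :
    insertTerm S m a (-(r : ℤ) - 2) = S (-(r : ℤ) - 1) := by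
  have hr := h.lt_period hm
  rw [← insertTerm_periodic S m a, insertTerm_of_lt (by omega) (by omega),
    ← h.periodic (-(r : ℤ) - 1)]
  congr 1; omega

end EndsWithRun

/-- Every integer is congruent modulo `m` to one in `[b, b + m)`. -/
lemma exists_modEq_mem_Ico {M : ℤ} (hM : 0 < M) (b p : ℤ) :
    ∃ i, i ≡ p [ZMOD M] ∧ b ≤ i ∧ i < b + M := by
  refine ⟨(p - b) % M + b, ?_, ?_, ?_⟩
  · have := (Int.mod_modEq (p - b) M).add_right b
    simpa using this
  · have := Int.emod_nonneg (p - b) hM.ne'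
    omega
  · have := Int.emod_lt_of_pos (p - b) hM
    omega

/-- If `S` has no constant run of length `r + 1`, the only one created is at the insertion. -/
lemma EndsWithRun.eq_of_run (h : EndsWithRun S m r a) (hm : 0 < m)
    (hS : ∀ (i : ℤ) (c : α), ∃ k : ℕ, k ≤ r ∧ S (i + k) ≠ c) {p : ℤ} {c : α}
    (hp : ∀ k : ℕ, k ≤ r → insertTerm S m a (p + k) = c) :
    c = a ∧ p ≡ -(r : ℤ) - 1 [ZMOD (m : ℤ) + 1] := by
  obtain ⟨i, hi, h1, h2⟩ := exists_modEq_mem_Ico (M := (m : ℤ) + 1) (by omega) (-(r : ℤ) - 1) p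
  have hi' : ∀ k : ℕ, k ≤ r → insertTerm S m a (i + k) = c := fun k hk => by
    rw [insertTerm_congr (hi.add_right k), hp k hk]
  rcases eq_or_ne i (-(r : ℤ) - 1) with h3 | h3
  · refine ⟨?_, h3 ▸ hi.symm⟩
    rw [← hi' 0 (by omega), h.insertTerm_eq_run hm (by omega) (by push_cast; omega)]
  · obtain ⟨k, hk, hne⟩ := hS i c
    exact absurd (by rw [← h.insertTerm_eq hm (by omega) (by omega), hi' k hk]) hne

/-- A window of the new sequence which does not cover the lengthened run is a window of the
old one. -/
lemma EndsWithRun.window_eq (h : EndsWithRun S m r a) (hm : 0 < m) {n : ℕ} (hn : r + 1 ≤ n)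
    {p : ℤ} (hp : ∀ t : ℕ, t + r + 1 ≤ n → ∃ k : ℕ, k ≤ r ∧ insertTerm S m a (p + t + k) ≠ a) :
    ∃ i, i ≡ p [ZMOD (m : ℤ) + 1] ∧ -(r : ℤ) ≤ i ∧ i < -(r : ℤ) + m ∧
      ∀ k : ℕ, k < n → insertTerm S m a (p + k) = S (i + k) := by
  obtain ⟨i, hi, h1, h2⟩ := exists_modEq_mem_Ico (M := (m : ℤ) + 1) (by omega) (-(r : ℤ)) p
  rcases le_or_gt (i + n) m with h3 | h3
  · refine ⟨i, hi, h1, by omega, fun k hk => ?_⟩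
    rw [← insertTerm_congr (hi.add_right k), h.insertTerm_eq hm (by omega) (by omega)]
  · exfalso
    obtain ⟨k, hk, hne⟩ := hp (m - r - i).toNat (by omega)
    apply hne
    rw [← insertTerm_congr ((hi.add_right _).add_right _),
      show i + ((m - r - i).toNat : ℤ) + k = -(r : ℤ) - 1 + k + (m + 1) by omega,
      insertTerm_periodic, h.insertTerm_eq_run hm (by omega) (by omega)]

end Insert

/-! ### Raising the order by one -/

/-- The invariant of the recursion. `S` has period `m` (it need not be stated that `m` is the
least period, as the windows of length `n` are distinct within a period), and for `e = 1`
(`e = -1`) no window of length `n` is the reverse (the negated reverse) of a window. Every run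
of `0` has length at most `r ≤ n - 2`, some string `x 0^r y` with `x ≠ e y` occurs, and the terms
of a period add up to a unit. -/
structure IsExtendable (q : ℕ) (e : ZMod q) (n m r : ℕ) (S : ℤ → ZMod q) : Prop where
  pos : 0 < m
  periodic : Function.Periodic S (m : ℤ)
  window_unique : ∀ i j : ℤ, (∀ k : ℕ, k < n → S (i + k) = S (j + k)) → i ≡ j [ZMOD (m : ℤ)]
  ne_reverse : ∀ i j : ℤ, ∃ k : ℕ, k < n ∧ S (i + k) ≠ e * S (j - k)
  run_le : ∀ i : ℤ, ∃ k : ℕ, k ≤ r ∧ S (i + k) ≠ 0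
  exists_run : ∃ i : ℤ, (∀ k : ℕ, k < r → S (i + 1 + k) = 0) ∧ S i ≠ e * S (i + r + 1)
  le_order : r + 2 ≤ n
  isUnit_weight : IsUnit (∑ i ∈ Finset.range m, S (i : ℤ))

section

variable {q : ℕ} {e : ZMod q} {n m r : ℕ}

lemma IsExtendable.isGoodOrientable {S : ℤ → ZMod q} (hq : 1 < q)
    (h : IsExtendable q 1 n m r S) : IsGoodOrientable q n m S where
  one_lt_alphabet := hq
  one_lt_order := by have := h.le_order; omega
  hasPeriod := by
    refine ⟨⟨h.pos, h.periodic⟩, fun p hp => ?_⟩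
    have h1 : (p : ℤ) ≡ 0 [ZMOD (m : ℤ)] := h.window_unique _ _ fun k _ => by
      rw [add_comm (p : ℤ), hp.2, zero_add]
    exact Nat.le_of_dvd hp.1 (Int.natCast_dvd_natCast.1 (Int.modEq_zero_iff_dvd.1 h1))
  window_unique := fun i j hij => h.window_unique i j fun k hk => congrFun hij ⟨k, hk⟩
  window_ne_reverse := fun i j hij => by
    obtain ⟨k, hk, hne⟩ := h.ne_reverse i (j + n - 1)
    apply hne
    have h1 := congrFun hij ⟨k, hk⟩
    simp only [window, reverse, Fin.val_rev] at h1
    rw [h1, one_mul]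
    congr 1; omega
  run_zero_le := fun j t hj => by
    obtain ⟨k, hk, hne⟩ := h.run_le j
    have h1 : ¬ k < t := fun hkt => hne (hj.eq_on k hkt)
    have := h.le_order
    omega

/-- Let `S` have no constant run longer than `r`, and let it read `x a^r y` around position `0`.
Lengthening this run to `a^(r+1)` creates only windows which contain that new string, so they
differ from all the old ones and from each other. Two of them are reverses of each other only
if `x = y`. They are negated reverses of each other, or of old windows, only if `a = -a`, as
`(-a)^(r+1)` does not occur otherwise. Both cases are excluded by `hside`. -/
lemma isExtendable_insertTerm {S : ℤ → ZMod q} {a : ZMod q} (he : e * e = 1) (hm : 0 < m)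
    (hr : 0 < r) (hn : r + 2 ≤ n) (ha : a ≠ 0) (hend : EndsWithRun S m r a)
    (hwin : ∀ i j : ℤ, (∀ k : ℕ, k < n → S (i + k) = S (j + k)) → i ≡ j [ZMOD (m : ℤ)])
    (hrev : ∀ i j : ℤ, ∃ k : ℕ, k < n ∧ S (i + k) ≠ e * S (j - k))
    (hrun : ∀ (i : ℤ) (c : ZMod q), ∃ k : ℕ, k ≤ r ∧ S (i + k) ≠ c)
    (hzero : ∃ i : ℤ, (∀ k : ℕ, k < r → S (i + 1 + k) = 0) ∧ S i ≠ e * S (i + r + 1))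
    (hside : e * a = a → S (-(r : ℤ) - 1) ≠ e * S 0)
    (hweight : IsUnit (∑ i ∈ Finset.range m, S (i : ℤ) + a)) :
    IsExtendable q e n (m + 1) r (insertTerm S m a) where
  pos := Nat.succ_pos _
  periodic := by exact_mod_cast insertTerm_periodic S m a
  window_unique := by
    push_cast
    intro p p' hpp
    -- Either the window covers a lengthened run, which then fixes its position, or it is a window
    -- of `S`.
    by_cases hfull : ∃ t : ℕ, t + r + 1 ≤ n ∧ ∀ k : ℕ, k ≤ r → insertTerm S m a (p + t + k) = a
    · obtain ⟨t, ht, hp⟩ := hfull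
      have hp' : ∀ k : ℕ, k ≤ r → insertTerm S m a (p' + t + k) = a := fun k hk => by
        have := hpp (t + k) (by omega)
        push_cast at this
        rw [← add_assoc, ← add_assoc] at this
        rw [← this, hp k hk]
      exact Int.ModEq.add_right_cancel' _
        ((hend.eq_of_run hm hrun hp).2.trans (hend.eq_of_run hm hrun hp').2.symm)
    · push Not at hfull
      obtain ⟨i, hi, hi1, hi2, hi3⟩ := hend.window_eq hm (by omega) hfull
      obtain ⟨j, hj, hj1, hj2, hj3⟩ := hend.window_eq (p := p') hm (n := n) (by omega)
        fun t ht => by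
          obtain ⟨k, hk, hne⟩ := hfull t ht
          refine ⟨k, hk, ?_⟩
          have := hpp (t + k) (by omega)
          push_cast at this
          rw [← add_assoc, ← add_assoc] at this
          rwa [← this]
      have hij := hwin i j fun k hk => by rw [← hi3 k hk, ← hj3 k hk, hpp k hk]
      have hij' : i = j := by
        obtain ⟨c, hc⟩ := (Int.modEq_iff_dvd.1 hij)
        have hc1 : c < 1 := by
          by_contra hcon
          nlinarith
        have hc2 : -1 < c := by
          by_contra hcon
          nlinarith
        obtain rfl : c = 0 := by omega
        omega
      exact hi.symm.trans (hij' ▸ hj)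
  ne_reverse := by
    intro p j
    by_contra! hpj
    have hback : ∀ x y : ZMod q, x = e * y → y = e * x := fun x y h => by
      rw [h, ← mul_assoc, he, one_mul]
    by_cases hfull : ∃ t : ℕ, t + r + 1 ≤ n ∧ ∀ k : ℕ, k ≤ r → insertTerm S m a (p + t + k) = a
    · obtain ⟨t, ht, hp⟩ := hfull
      have hj : ∀ k : ℕ, k ≤ r → insertTerm S m a (j - t - r + k) = e * a := fun k hk => by
        have := hpj (t + (r - k)) (by omega)
        have h2 := hp (r - k) (by omega)
        push_cast [hk] at this h2
        rw [add_assoc] at h2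
        rw [h2] at this
        rw [← hback _ _ this]
        congr 1; ring
      obtain ⟨hea, hj'⟩ := hend.eq_of_run hm hrun hj
      obtain ⟨-, hp'⟩ := hend.eq_of_run hm hrun hp
      rcases Nat.eq_zero_or_pos t with h0 | h0
      -- Compare the neighbours of the two runs on the side where the windows contain them.
      · have := hpj (r + 1) (by omega)
        rw [insertTerm_congr (j := 0) (by simpa [h0] using hp'.add_right (r + 1 : ℤ)),
          insertTerm_congr (i := j - (r + 1 : ℕ)) (j := -(r : ℤ) - 2)
            (by convert hj'.sub_right 1 using 1
                · push_cast [h0]; ring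
                · ring),
          hend.insertTerm_before hm, insertTerm_of_lt le_rfl (by omega)] at this
        exact hside hea (hback _ _ this)
      · have := hpj (t - 1) (by omega)
        rw [insertTerm_congr (i := p + (t - 1 : ℕ)) (j := -(r : ℤ) - 2)
            (by convert hp'.sub_right 1 using 1
                · push_cast [h0]; ring
                · ring),
          insertTerm_congr (i := j - (t - 1 : ℕ)) (j := 0)
            (by convert hj'.add_right (r + 1 : ℤ) using 1
                · push_cast [h0]; ring
                · ring),
          hend.insertTerm_before hm, insertTerm_of_lt le_rfl (by omega)] at this
        exact hside hea this
    · have hfull' := hfull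
      push Not at hfull'
      obtain ⟨i, hi, hi1, hi2, hi3⟩ := hend.window_eq hm (by omega) hfull'
      obtain ⟨i', hi', hi1', hi2', hi3'⟩ := hend.window_eq (p := j - n + 1) hm (n := n) (by omega)
        fun t ht => by
          by_contra! hcon
          have hp : ∀ k : ℕ, k ≤ r →
              insertTerm S m a (p + (n - t - r - 1 : ℕ) + k) = e * a := fun k hk => by
            have h1 := hpj (n - t - r - 1 + k) (by omega)
            rw [show j - ((n - t - r - 1 + k : ℕ) : ℤ) = j - n + 1 + t + (r - k : ℕ) by omega,
              hcon _ (by omega)] at h1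
            rw [← h1]; congr 1; omega
          have hea := (hend.eq_of_run hm hrun hp).1
          exact hfull ⟨n - t - r - 1, by omega, fun k hk => (hp k hk).trans hea⟩
      obtain ⟨k, hk, hne⟩ := hrev i (i' + n - 1)
      apply hne
      rw [← hi3 k hk, hpj k hk, show i' + (n : ℤ) - 1 - k = i' + (n - 1 - k : ℕ) by omega,
        ← hi3' _ (by omega)]
      congr 2; omega
  run_le := by
    intro p
    by_contra! hp
    exact ha (hend.eq_of_run hm hrun hp).1.symm
  exists_run := by
    obtain ⟨p, hp, hne⟩ := hzero
    obtain ⟨i, hi, h1, h2⟩ := exists_modEq_mem_Ico (M := (m : ℤ)) (by omega) (-(r : ℤ)) p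
    have hS : ∀ z, S (i + z) = S (p + z) := fun z => by
      obtain ⟨c, hc⟩ := Int.modEq_iff_dvd.1 hi
      rw [show p + z = i + z + c * m by linarith]
      exact (hend.periodic.int_mul c _).symm
    have hi3 : i + r + 1 < m := by
      by_contra hcon
      have h3 := hend.eq_on (-r) le_rfl (by omega)
      rw [← hend.periodic, show -(r : ℤ) + m = i + 1 by omega, hS 1] at h3
      have h4 := hp 0 hr
      simp only [Nat.cast_zero, add_zero] at h4
      exact ha (h3.symm.trans h4)
    refine ⟨i, fun k hk => ?_, ?_⟩
    · rw [hend.insertTerm_eq hm (by omega) (by omega), add_assoc, hS, ← add_assoc, hp k hk]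
    · rw [hend.insertTerm_eq hm (by omega) (by omega),
        hend.insertTerm_eq hm (by omega) (by omega), add_assoc, hS, ← add_assoc]
      have := hS 0
      simp only [add_zero] at this
      rwa [this]
  le_order := hn
  isUnit_weight := by
    rw [Finset.sum_range_succ, insertTerm_self]
    convert hweight using 3 with i hi
    exact insertTerm_of_lt (by omega) (by have := Finset.mem_range.1 hi; omega)

end

lemma two_mul_sum_range_mul {R : Type*} [CommRing R] {S : ℤ → R} {m : ℕ} {w : R}
    (hS : ∀ i, S (i + m) = S i + w) (k : ℕ) :
    2 * ∑ i ∈ Finset.range (k * m), S (i : ℤ)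
      = k * (2 * ∑ i ∈ Finset.range m, S (i : ℤ) + (k - 1) * m * w) := by
  have hS' : ∀ (k : ℕ) (i : ℤ), S (k * m + i) = S i + k * w := by
    intro k
    induction k with
    | zero => simp
    | succ k ih =>
      intro i
      rw [show ((k + 1 : ℕ) : ℤ) * m + i = k * m + i + m by push_cast; ring, hS, ih]
      push_cast; ring
  induction k with
  | zero => simp
  | succ k ih =>
    rw [add_mul, one_mul, Finset.sum_range_add, mul_add, ih]
    push_cast
    simp only [hS', Finset.sum_add_distrib, Finset.sum_const, Finset.card_range, nsmul_eq_mul]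
    ring

lemma antiderivative_add_mul {R : Type*} [CommRing R] {S : ℤ → R} {m : ℕ} {w : R}
    (hS : ∀ i, S (i + m) = S i + w) (i c : ℤ) : S (i + c * m) = S i + c * w := by
  induction c using Int.induction_on with
  | zero => simp
  | succ k ih =>
    rw [show i + ((k : ℤ) + 1) * m = i + k * m + m by ring, hS, ih]; push_cast; ring
  | pred k ih =>
    have := hS (i + (-(k : ℤ) - 1) * m)
    rw [show i + (-(k : ℤ) - 1) * m + m = i + -(k : ℤ) * m by ring, ih] at this
    rw [← sub_eq_iff_eq_add] at this
    rw [← this]; push_cast; ring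

/-- The recursion. The antiderivative `S₀` of `T` has period `q m` since the weight `w` of `T` is
a unit: `S₀ (i + m) = S₀ i + w`. Differences turn reversal into negated reversal, so the sign
changes; a run of a constant in `S₀` comes from a run of `0` in `T` which is shorter by one.
The weight `W` of `S₀` satisfies `2 W = 0`, so inserting `a = 1 - W` makes the weight `1`, and
`a` is neither `0` nor equal to `-a`. -/
theorem IsExtendable.exists_succ {q : ℕ} {e : ZMod q} {n m r : ℕ} {T : ℤ → ZMod q} (hq : 2 < q)
    (he : e = 1 ∨ e = -1) (h : IsExtendable q e n m r T) :
    ∃ S, IsExtendable q (-e) (n + 1) (q * m + 1) (r + 1) S := by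
  have hee : e * e = 1 := by rcases he with rfl | rfl <;> ring
  have : NeZero q := ⟨by omega⟩
  have htwo : (2 : ZMod q) ≠ 0 := fun h2 => by
    have : ((2 : ℕ) : ZMod q) = 0 := by exact_mod_cast h2
    rw [ZMod.natCast_eq_zero_iff] at this
    exact absurd (Nat.le_of_dvd (by norm_num) this) (by omega)
  obtain ⟨S₀, hS₀⟩ := exists_antiderivative T
  set w := ∑ i ∈ Finset.range m, T (i : ℤ) with hw
  have hadd := antiderivative_add_mul (antiderivative_add_period h.periodic hS₀)
  rw [← hw] at hadd
  have hdiff : ∀ i, T i = S₀ (i + 1) - S₀ i := fun i => by rw [hS₀]; ring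
  have hper : Function.Periodic S₀ ((q * m : ℕ) : ℤ) := fun i => by
    push_cast; rw [hadd]; simp
  set W := ∑ i ∈ Finset.range (q * m), S₀ (i : ℤ) with hW
  have hWW : 2 * W = 0 := by
    rw [hW, two_mul_sum_range_mul (antiderivative_add_period h.periodic hS₀)]; simp
  have hwin : ∀ i j : ℤ, (∀ k : ℕ, k < n + 1 → S₀ (i + k) = S₀ (j + k)) →
      i ≡ j [ZMOD ((q * m : ℕ) : ℤ)] := by
    intro i j hij
    obtain ⟨c, hc⟩ := Int.modEq_iff_dvd.1 (h.window_unique i j fun k hk => by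
      have h1 := hij k (by omega)
      have h2 := hij (k + 1) (by omega)
      push_cast at h2
      rw [hdiff, hdiff, h1, add_assoc, add_assoc, h2])
    have h0 := hij 0 (by omega)
    rw [show j = i + c * m by linarith] at h0 ⊢
    simp only [Nat.cast_zero, add_zero] at h0
    rw [hadd, left_eq_add, h.isUnit_weight.mul_left_eq_zero, ZMod.intCast_zmod_eq_zero_iff_dvd]
      at h0
    obtain ⟨d, rfl⟩ := h0
    refine Int.modEq_iff_dvd.2 ⟨d, ?_⟩
    push_cast; ring
  have hrev : ∀ i j : ℤ, ∃ k : ℕ, k < n + 1 ∧ S₀ (i + k) ≠ -e * S₀ (j - k) := by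
    intro i j
    by_contra! hij
    obtain ⟨k, hk, hne⟩ := h.ne_reverse i (j - 1)
    apply hne
    have h1 := hij k (by omega)
    have h2 := hij (k + 1) (by omega)
    push_cast at h2
    rw [hdiff, hdiff, add_assoc, h1, h2, show j - 1 - (k : ℤ) + 1 = j - k by ring,
      show j - ((k : ℤ) + 1) = j - 1 - k by ring]
    ring
  have hrun : ∀ (i : ℤ) (c : ZMod q), ∃ k : ℕ, k ≤ r + 1 ∧ S₀ (i + k) ≠ c := by
    intro i c
    by_contra! hi
    obtain ⟨k, hk, hne⟩ := h.run_le i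
    apply hne
    have h2 := hi (k + 1) (by omega)
    push_cast at h2
    rw [hdiff, hi k (by omega), add_assoc, h2, sub_self]
  -- As `w` is a unit, the translates of the string `x 0^r y` of `T` by multiples of `m` give
  -- runs of every constant `b`.
  obtain ⟨p, hp, hpne⟩ := h.exists_run
  have hex : ∀ b : ZMod q, ∃ i : ℤ, (∀ k : ℕ, k < r + 1 → S₀ (i + 1 + k) = b) ∧
      S₀ i = b - T p ∧ S₀ (i + (r + 1 : ℕ) + 1) = b + T (p + r + 1) := by
    intro b
    obtain ⟨v, hv⟩ := h.isUnit_weight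
    obtain ⟨c, hc⟩ := ZMod.intCast_surjective ((b - S₀ (p + 1)) * ((v⁻¹ : (ZMod q)ˣ) : ZMod q))
    have hcw : (c : ZMod q) * w = b - S₀ (p + 1) := by
      rw [hc, hw, ← hv, mul_assoc, Units.inv_mul, mul_one]
    have hb : ∀ k : ℕ, k < r + 1 → S₀ (p + c * m + 1 + k) = b := by
      intro k hk
      induction k with
      | zero =>
        rw [show p + c * m + 1 + ((0 : ℕ) : ℤ) = p + 1 + c * m by push_cast; ring, hadd, hcw]
        ring
      | succ k ih =>
        have h1 := hp k (by omega)
        rw [← h.periodic.int_mul c] at h1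
        push_cast
        rw [← add_assoc, hS₀, ih (by omega),
          show p + c * m + 1 + (k : ℤ) = p + 1 + k + c * m by ring]
        simp only [Int.cast_id] at h1
        rw [h1, add_zero]
    refine ⟨p + c * m, hb, ?_, ?_⟩
    · have h1 := hb 0 (by omega)
      have h2 := hS₀ (p + c * m)
      simp only [Nat.cast_zero, add_zero] at h1
      have h3 : T (p + c * m) = T p := h.periodic.int_mul c p
      rw [h1, h3] at h2
      rw [h2]; ring
    · have h3 : T (p + r + 1 + c * m) = T (p + r + 1) := h.periodic.int_mul c _
      rw [hS₀, show p + c * m + ((r + 1 : ℕ) : ℤ) = p + c * m + 1 + r by push_cast; ring,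
        hb r (by omega), ← h3]
      congr 2; ring
  have ha : 1 - W ≠ 0 := fun hcon => htwo (by
    rw [← hWW, ← sub_eq_zero.1 hcon, mul_one])
  obtain ⟨i, hi, hix, hiy⟩ := hex (1 - W)
  obtain ⟨z, hz, hzx, hzy⟩ := hex 0
  set d := i + r + 2 with hd
  refine ⟨insertTerm (fun t => S₀ (t + d)) (q * m) (1 - W), isExtendable_insertTerm
    (by rw [neg_mul_neg, hee]) (Nat.mul_pos (by omega) h.pos) (Nat.succ_pos r)
    (by have := h.le_order; omega) ha ?_ ?_ ?_ ?_ ?_ ?_ ?_⟩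
  · refine ⟨fun t => ?_, ?_, fun t h1 h2 => ?_⟩
    · rw [← hper (t + d)]
      congr 1; ring
    · intro hcon
      obtain ⟨k, hk, hne⟩ := hrun i (1 - W)
      rcases Nat.eq_zero_or_pos k with rfl | hk0
      · apply hne
        rw [← hcon]; congr 1; push_cast; omega
      · apply hne
        rw [← hi (k - 1) (by omega)]; congr 1; omega
    · rw [← hi (t + r + 1).toNat (by omega)]
      congr 1; omega
  · intro i j hij
    refine Int.ModEq.add_right_cancel' d (hwin _ _ fun k hk => ?_)
    rw [add_right_comm, add_right_comm j]
    exact hij k hk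
  · intro i j
    obtain ⟨k, hk, hne⟩ := hrev (i + d) (j + d)
    refine ⟨k, hk, ?_⟩
    rwa [add_right_comm, add_sub_right_comm] at hne
  · intro i c
    obtain ⟨k, hk, hne⟩ := hrun (i + d) c
    refine ⟨k, hk, ?_⟩
    rwa [add_right_comm] at hne
  · refine ⟨z - d, fun k hk => ?_, ?_⟩
    · rw [← hz k hk]; congr 1; ring
    · rw [show z - d + d = z by ring,
        show z - d + ((r + 1 : ℕ) : ℤ) + 1 + d = z + (r + 1 : ℕ) + 1 by ring, hzx, hzy]
      intro hcon
      exact hpne (by linear_combination -hcon)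
  · rw [show -((r + 1 : ℕ) : ℤ) - 1 + d = i by push_cast; omega,
      show (0 : ℤ) + d = i + (r + 1 : ℕ) + 1 by push_cast; omega, hix, hiy]
    intro hea hcon
    rcases he with rfl | rfl
    · exact htwo (by linear_combination -hea + hWW)
    · exact hpne (by linear_combination -hcon)
  · rw [sum_range_add_int_of_periodic hper, ← hW, add_sub_cancel]
    exact isUnit_one

lemma IsExtendable.exists_iterate {q n m : ℕ} (hq : 2 < q) {T : ℤ → ZMod q}
    (h : IsExtendable q (-1) n m 0 T) (s : ℕ) :
    ∃ (M r : ℕ) (S : ℤ → ZMod q), IsExtendable q 1 (n + (2 * s + 1)) M r S ∧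
      (q : ℚ) ^ (2 * s + 1) * m + ((q : ℚ) ^ (2 * s + 1) - 1) / ((q : ℚ) - 1) = M := by
  have hq1 : (q : ℚ) - 1 ≠ 0 := by
    have : (2 : ℚ) < q := by exact_mod_cast hq
    linarith
  induction s with
  | zero =>
    obtain ⟨S, hS⟩ := h.exists_succ hq (Or.inr rfl)
    rw [neg_neg] at hS
    refine ⟨_, _, S, hS, ?_⟩
    push_cast
    field_simp
  | succ s ih =>
    obtain ⟨M, r, S, hS, hM⟩ := ih
    obtain ⟨S', hS'⟩ := hS.exists_succ hq (Or.inl rfl)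
    obtain ⟨S'', hS''⟩ := hS'.exists_succ hq (Or.inr rfl)
    rw [neg_neg] at hS''
    refine ⟨_, _, S'', hS'', ?_⟩
    push_cast
    rw [← hM]
    field_simp
    ring

/-! ### Merging cycles of a permutation -/

/-- Multiplying by a transposition merges two cycles. -/
lemma sameCycle_mul_swap {α : Type*} [Finite α] [DecidableEq α] {σ : Equiv.Perm α} {e f : α}
    (hef : ¬ σ.SameCycle e f) : (σ * Equiv.swap e f).SameCycle e f := by
  by_contra hcon
  set ρ := σ * Equiv.swap e f with hρ
  have hρe : ρ e = σ f := by simp [hρ]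
  -- The `ρ`-orbit of `e` starts at `σ f` and then follows `σ`, as it avoids `f`.
  have key : ∀ k : ℕ, σ.SameCycle f ((ρ ^ (k + 1)) e) := by
    intro k
    induction k with
    | zero => simp [hρe, Equiv.Perm.SameCycle.refl]
    | succ k ih =>
      rw [pow_succ', Equiv.Perm.mul_apply]
      set g := (ρ ^ (k + 1)) e with hg
      have hgf : g ≠ f := fun h => hcon ⟨(k + 1 : ℕ), by rw [zpow_natCast, ← hg, h]⟩
      have hge : g ≠ e := fun h => hef (h ▸ ih).symm
      have : ρ g = σ g := by simp [hρ, Equiv.swap_apply_of_ne_of_ne hge hgf]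
      rw [this]
      exact Equiv.Perm.sameCycle_apply_right.2 ih
  obtain ⟨k, hk⟩ : ∃ k : ℕ, ρ ^ (k + 1) = 1 :=
    ⟨orderOf ρ - 1, by rw [Nat.sub_add_cancel (orderOf_pos ρ), pow_orderOf_eq_one]⟩
  have := key k
  rw [hk] at this
  exact hef this.symm

lemma sameCycle_mul_swap_of_sameCycle {α : Type*} [Finite α] [DecidableEq α]
    {σ : Equiv.Perm α} {e f x y : α} (hef : ¬ σ.SameCycle e f) (hxy : σ.SameCycle x y) :
    (σ * Equiv.swap e f).SameCycle x y := by
  have h := sameCycle_mul_swap hef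
  set ρ := σ * Equiv.swap e f with hρ
  have step : ∀ g, ρ.SameCycle g (σ g) := by
    intro g
    by_cases hge : g = e
    · subst hge
      have : σ g = ρ f := by simp [hρ]
      rw [this]
      exact Equiv.Perm.sameCycle_apply_right.2 h
    by_cases hgf : g = f
    · subst hgf
      have : σ g = ρ e := by simp [hρ]
      rw [this]
      exact Equiv.Perm.sameCycle_apply_right.2 h.symm
    · have : σ g = ρ g := by simp [hρ, Equiv.swap_apply_of_ne_of_ne hge hgf]
      rw [this]
      exact Equiv.Perm.sameCycle_apply_right.2 (Equiv.Perm.SameCycle.refl _ _)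
  obtain ⟨k, -, rfl⟩ := hxy.exists_pow_eq'
  induction k with
  | zero => simp [Equiv.Perm.SameCycle.refl]
  | succ k ih =>
    rw [pow_succ', Equiv.Perm.mul_apply]
    exact (ih ⟨k, by simp⟩).trans (step _)

/-- Euler's theorem on closed trails, for a digraph with edge set `α` given by a decomposition
into cycles. The permutation `σ` maps an edge to the next one in its cycle and `head` gives
the end point of an edge, so that `σ * τ` runs through closed trails if `τ` respects `head`.
The graph being connected, `τ` can be chosen such that there is only one closed trail. -/
theorem exists_perm_sameCycle {α V : Type*} [Finite α] (σ : Equiv.Perm α) (head : α → V)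
    (hconn : ∀ C : Set α, C.Nonempty → (∀ x, σ x ∈ C ↔ x ∈ C) →
      (∀ x ∈ C, ∀ y, head x = head y → y ∈ C) → C = Set.univ) :
    ∃ τ : Equiv.Perm α, (∀ x, head (τ x) = head x) ∧ ∀ x y, (σ * τ).SameCycle x y := by
  classical
  rcases isEmpty_or_nonempty α with hα | ⟨⟨a⟩⟩
  · exact ⟨1, fun x => rfl, fun x => hα.elim x⟩
  have : Fintype α := Fintype.ofFinite α
  have : Nonempty {τ : Equiv.Perm α // ∀ x, head (τ x) = head x} := ⟨⟨1, fun _ => rfl⟩⟩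
  -- Among all the `τ`, choose one for which the trail through `a` is longest.
  obtain ⟨⟨τ, hτ⟩, hmax⟩ := Finite.exists_max
    (fun τ : {τ : Equiv.Perm α // ∀ x, head (τ x) = head x} =>
      Set.ncard {x | (σ * τ.1).SameCycle a x})
  have hτ' : ∀ x, head (τ⁻¹ x) = head x := fun x => by
    rw [← hτ (τ⁻¹ x)]; simp
  have hclosed : ∀ x, (σ * τ).SameCycle a x → ∀ y, head x = head y → (σ * τ).SameCycle a y := by
    intro x hx y hxy
    by_contra hy
    have hnot : ¬ (σ * τ).SameCycle x y := fun h => hy (hx.trans h)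
    have := hmax ⟨τ * Equiv.swap x y, fun z => by
      rw [Equiv.Perm.mul_apply, hτ]
      by_cases hzx : z = x
      · rw [hzx, Equiv.swap_apply_left, hxy]
      by_cases hzy : z = y
      · rw [hzy, Equiv.swap_apply_right, hxy]
      rw [Equiv.swap_apply_of_ne_of_ne hzx hzy]⟩
    simp only [← mul_assoc] at this
    refine absurd this (not_le.2 (Set.ncard_lt_ncard ⟨fun z hz =>
      sameCycle_mul_swap_of_sameCycle hnot hz, fun hsub => hy (hsub ?_)⟩ (Set.toFinite _)))
    exact (sameCycle_mul_swap_of_sameCycle hnot hx).trans (sameCycle_mul_swap hnot)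
  have huniv := hconn {x | (σ * τ).SameCycle a x} ⟨a, Equiv.Perm.SameCycle.refl _ _⟩
    (fun x => by
      change (σ * τ).SameCycle a (σ x) ↔ (σ * τ).SameCycle a x
      have h1 : σ x = (σ * τ) (τ⁻¹ x) := by simp
      rw [h1, Equiv.Perm.sameCycle_apply_right]
      exact ⟨fun h => hclosed _ h x (hτ' x), fun h => hclosed _ h _ (hτ' x).symm⟩) hclosed
  have hall : ∀ x, (σ * τ).SameCycle a x := fun x => by
    have : x ∈ {x | (σ * τ).SameCycle a x} := huniv ▸ Set.mem_univ x
    exact this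
  exact ⟨τ, hτ, fun x y => (hall x).symm.trans (hall y)⟩

/-! ### Sequences with a prescribed set of windows -/

/-- Cyclic rotation `(u_0, …, u_n) ↦ (u_1, …, u_n, u_0)`. -/
def rotate {α : Type*} (n : ℕ) : Equiv.Perm (Fin (n + 1) → α) :=
  (finRotate (n + 1)).symm.arrowCongr (Equiv.refl α)

lemma rotate_apply {α : Type*} {n : ℕ} (u : Fin (n + 1) → α) (k : Fin (n + 1)) :
    rotate n u k = u (finRotate (n + 1) k) := rfl

lemma rotate_castSucc {α : Type*} {n : ℕ} (u : Fin (n + 1) → α) (k : Fin n) :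
    rotate n u k.castSucc = u k.succ := by
  rw [rotate_apply, finRotate_apply, Fin.coeSucc_eq_succ]

/-- If a finite set `E` of words is closed under rotation, and any two of them are connected
through rotations and changes of the first letter, then there is a periodic sequence in which
each word of `E` occurs exactly once in a period, and which has no other windows. -/
theorem exists_sequence_of_connected {α : Type*} {n : ℕ} (E : Finset (Fin (n + 1) → α))
    (hE : E.Nonempty) (hrot : ∀ u, rotate n u ∈ E ↔ u ∈ E)
    (hconn : ∀ C : Set (Fin (n + 1) → α), C ⊆ E → C.Nonempty → (∀ u, rotate n u ∈ C ↔ u ∈ C) →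
      (∀ u ∈ C, ∀ v ∈ E, (∀ k, k ≠ 0 → u k = v k) → v ∈ C) → C = E) :
    ∃ S : ℤ → α, Function.Periodic S (E.card : ℤ) ∧
      (∀ i : ℤ, (fun k : Fin (n + 1) => S (i + (k : ℕ))) ∈ E) ∧
      (∀ i j : ℤ, (∀ k : ℕ, k < n + 1 → S (i + k) = S (j + k)) → i ≡ j [ZMOD (E.card : ℤ)]) ∧
      ∀ {M : Type*} [AddCommMonoid M] (F : α → M),
        ∑ i ∈ Finset.range E.card, F (S (i : ℤ)) = ∑ u ∈ E, F (u 0) := by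
  classical
  -- A word is an edge from its prefix to its suffix of length `n`; rotation gives a
  -- decomposition of the graph into cycles.
  let ρ : Equiv.Perm E := (rotate n).subtypePerm fun u => hrot u
  obtain ⟨τ, hτ, hcyc⟩ := exists_perm_sameCycle ρ (fun u : E => Fin.tail u.1) (by
    intro C hC h1 h2
    have := hconn (Subtype.val '' C) (by rintro _ ⟨u, -, rfl⟩; exact u.2) (hC.image _)
      (by
        intro u
        constructor
        · rintro ⟨v, hv, hvu⟩
          have hu : u ∈ E := (hrot u).1 (hvu ▸ v.2)
          have huv : ρ ⟨u, hu⟩ = v := Subtype.ext hvu.symm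
          exact ⟨⟨u, hu⟩, (h1 ⟨u, hu⟩).1 (huv ▸ hv), rfl⟩
        · rintro ⟨v, hv, rfl⟩
          exact ⟨_, (h1 v).2 hv, rfl⟩)
      (by
        rintro _ ⟨u, hu, rfl⟩ v hv huv
        exact ⟨⟨v, hv⟩, h2 u hu _ (funext fun k => huv k.succ (Fin.succ_ne_zero k)), rfl⟩)
    refine Set.eq_univ_of_forall fun u => ?_
    have hu : u.1 ∈ Subtype.val '' C := this ▸ u.2
    obtain ⟨v, hv, hvu⟩ := hu
    exact Subtype.ext hvu ▸ hv)
  set σ := ρ * τ with hσ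
  obtain ⟨u₀, hu₀⟩ := hE
  let e : ℤ → E := fun i => (σ ^ i) ⟨u₀, hu₀⟩
  have hnext : ∀ (i : ℤ) (k : Fin n), (e (i + 1)).1 k.castSucc = (e i).1 k.succ := by
    intro i k
    have h1 : e (i + 1) = ρ (τ (e i)) := by
      simp only [e, add_comm i 1, zpow_add, zpow_one, Equiv.Perm.mul_apply, hσ]
    have h2 := congrFun (hτ (e i)) k
    rw [h1]
    exact (rotate_castSucc _ k).trans h2
  have hval : ∀ (k : ℕ) (hk : k < n + 1) (i : ℤ), (e (i + k)).1 0 = (e i).1 ⟨k, hk⟩ := by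
    intro k
    induction k with
    | zero => intro hk i; simp
    | succ k ih =>
      intro hk i
      have := ih (by omega) (i + 1)
      rw [Nat.cast_succ, add_comm (k : ℤ) 1, ← add_assoc, this]
      exact hnext i ⟨k, by omega⟩
  have hwin : ∀ i : ℤ, (fun k : Fin (n + 1) => (e (i + (k : ℕ))).1 0) = (e i).1 :=
    fun i => funext fun k => hval k k.2 i
  have hcycle : σ.IsCycleOn (Finset.univ : Finset E) :=
    ⟨by simpa using Set.bijOn_univ.2 σ.bijective, fun x _ y _ => hcyc x y⟩
  have hcard : (Finset.univ : Finset E).card = E.card := by simp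
  have hemod : ∀ i j : ℤ, e i = e j ↔ i ≡ j [ZMOD (E.card : ℤ)] := fun i j => by
    rw [hcycle.zpow_apply_eq_zpow_apply (Finset.mem_univ _), hcard]
  refine ⟨fun i => (e i).1 0, fun i => ?_, fun i => ?_, fun i j hij => ?_, fun F => ?_⟩
  · have : e (i + E.card) = e i := (hemod _ _).2 (by simp [Int.ModEq])
    simp only [this]
  · rw [hwin]; exact (e i).2
  · refine (hemod i j).1 (Subtype.ext ?_)
    rw [← hwin i, ← hwin j]
    exact funext fun k => hij k k.2
  · rw [← Finset.sum_coe_sort E (fun u => F (u 0))]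
    refine Finset.sum_bij (fun i _ => e i) (fun _ _ => Finset.mem_univ _) ?_ ?_ (fun _ _ => rfl)
    · intro i hi j hj hij
      have := (hemod i j).1 hij
      have h1 := Finset.mem_range.1 hi
      have h2 := Finset.mem_range.1 hj
      rw [Int.natCast_modEq_iff] at this
      exact Nat.ModEq.eq_of_lt_of_lt this h1 h2
    · intro u _
      obtain ⟨k, hk, hku⟩ := hcycle.exists_pow_eq (Finset.mem_univ ⟨u₀, hu₀⟩) (Finset.mem_univ u)
      exact ⟨k, Finset.mem_range.2 (hcard ▸ hk), by simp only [e, zpow_natCast]; exact hku⟩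

/-! ### Words of positive weight -/

/-- An integer weight on the letters: `q + i` for `0 < i < q / 2`, its negative for `-i`, and `0`
for `q / 2`. (The value at the letter `0` does not matter.) The sum of the weights of three
nonzero letters vanishes only in the case of `q / 2`, `i` and `-i`, in any order. -/
def letterWeight (q : ℕ) (x : ZMod q) : ℤ :=
  if 2 * x.val < q then x.val + q else if 2 * x.val = q then 0 else x.val - 2 * q

/-- The words of length `n + 1` without the letter `0` whose weight is positive. Permuting the
letters of such a word gives another one, and negating them does not. -/
def positiveWords (q n : ℕ) [NeZero q] : Finset (Fin (n + 1) → ZMod q) :=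
  Finset.univ.filter fun u => (∀ k, u k ≠ 0) ∧ 0 < ∑ k, letterWeight q (u k)

lemma letterWeight_natCast {q i : ℕ} (hi : 2 * i < q) : letterWeight q (i : ZMod q) = i + q := by
  have : (i : ZMod q).val = i := ZMod.val_cast_of_lt (by omega)
  rw [letterWeight, this, if_pos hi]

lemma natCast_ne_natCast_of_lt {q i j : ℕ} (hi : i < q) (hj : j < q) (hij : i ≠ j) :
    (i : ZMod q) ≠ (j : ZMod q) := fun h => hij (by
  have := congrArg ZMod.val h
  rwa [ZMod.val_cast_of_lt hi, ZMod.val_cast_of_lt hj] at this)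

section

variable {q n : ℕ} [NeZero q]

lemma mem_positiveWords {u : Fin (n + 1) → ZMod q} :
    u ∈ positiveWords q n ↔ (∀ k, u k ≠ 0) ∧ 0 < ∑ k, letterWeight q (u k) := by
  simp [positiveWords]

lemma letterWeight_neg {x : ZMod q} (hx : x ≠ 0) : letterWeight q (-x) = -letterWeight q x := by
  have h1 : (-x).val = q - x.val := by rw [ZMod.neg_val, if_neg hx]
  have h2 := ZMod.val_lt x
  unfold letterWeight
  rw [h1]
  split_ifs <;> omega

lemma letterWeight_injOn {x y : ZMod q} (hx : x ≠ 0) (hy : y ≠ 0)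
    (h : letterWeight q x = letterWeight q y) : x = y := by
  apply ZMod.val_injective q
  have h1 := ZMod.val_lt x
  have h2 := ZMod.val_lt y
  have h3 := (ZMod.val_ne_zero x).2 hx
  have h4 := (ZMod.val_ne_zero y).2 hy
  unfold letterWeight at h
  split_ifs at h <;> omega

lemma letterWeight_le (hq : 2 < q) (x : ZMod q) :
    letterWeight q x ≤ letterWeight q (((q - 1) / 2 : ℕ) : ZMod q) := by
  rw [letterWeight_natCast (by omega)]
  have h1 := ZMod.val_lt x
  unfold letterWeight
  split_ifs <;> omega

lemma rotate_mem_positiveWords (u : Fin (n + 1) → ZMod q) :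
    rotate n u ∈ positiveWords q n ↔ u ∈ positiveWords q n := by
  have h1 : ∑ k, letterWeight q (rotate n u k) = ∑ k, letterWeight q (u k) :=
    Equiv.sum_comp (finRotate (n + 1)) fun k => letterWeight q (u k)
  have h2 : (∀ k, rotate n u k ≠ 0) ↔ ∀ k, u k ≠ 0 :=
    (finRotate (n + 1)).forall_congr_right (q := fun k => u k ≠ 0)
  rw [mem_positiveWords, mem_positiveWords, h1, h2]

lemma rotate_eq_const_iff {α : Type*} {u : Fin (n + 1) → α} {c : α} :
    rotate n u = (fun _ => c) ↔ u = fun _ => c := by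
  rw [funext_iff, funext_iff]
  exact (finRotate (n + 1)).forall_congr_right (q := fun k => u k = c)

/-- A set closed under rotations and changes of the first letter (within `E`) is closed under
changes of any letter. -/
lemma mem_of_eq_off {α : Type*} {E C : Set (Fin (n + 1) → α)}
    (hE : ∀ u, rotate n u ∈ E ↔ u ∈ E) (hrot : ∀ u, rotate n u ∈ C ↔ u ∈ C)
    (hfirst : ∀ u ∈ C, ∀ v ∈ E, (∀ k, k ≠ 0 → u k = v k) → v ∈ C) (i : Fin (n + 1)) :
    ∀ u ∈ C, ∀ v ∈ E, (∀ k, k ≠ i → u k = v k) → v ∈ C := by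
  induction i using Fin.induction with
  | zero => exact hfirst
  | succ i ih =>
    intro u hu v hv huv
    refine (hrot v).1 (ih _ ((hrot u).2 hu) _ ((hE v).2 hv) fun k hk => huv _ fun hcon => hk ?_)
    apply (finRotate (n + 1)).injective
    change finRotate (n + 1) k = i.succ at hcon
    rw [hcon, finRotate_apply, Fin.coeSucc_eq_succ]

/-- The words of positive weight, with at most one constant word `c … c` left out, are connected:
raising the letters of a word to the one of largest weight, one after the other, one stays
within this set. -/
lemma positiveWords_erase_connected (hq : 2 < q) {c : ZMod q} (hc : c ≠ ((q - 1) / 2 : ℕ))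
    (C : Set (Fin (n + 1) → ZMod q)) (hCE : C ⊆ (positiveWords q n).erase fun _ => c)
    (hne : C.Nonempty) (hrot : ∀ u, rotate n u ∈ C ↔ u ∈ C)
    (hfirst : ∀ u ∈ C, ∀ v ∈ (positiveWords q n).erase fun _ => c,
      (∀ k, k ≠ 0 → u k = v k) → v ∈ C) :
    C = (positiveWords q n).erase fun _ => c := by
  set E := (positiveWords q n).erase fun _ => c with hE
  set t : ZMod q := (((q - 1) / 2 : ℕ) : ZMod q) with ht
  have hErot : ∀ u, rotate n u ∈ (E : Set (Fin (n + 1) → ZMod q)) ↔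
      u ∈ (E : Set (Fin (n + 1) → ZMod q)) := fun u => by
    simp only [hE, Finset.mem_coe, Finset.mem_erase, rotate_mem_positiveWords, Ne,
      rotate_eq_const_iff]
  have ht0 : t ≠ 0 := by
    have := natCast_ne_natCast_of_lt (q := q) (i := (q - 1) / 2) (j := 0) (by omega) (by omega)
      (by omega)
    simpa using this
  have hmem : ∀ u ∈ E, ∀ s : Finset (Fin (n + 1)), (fun k => if k ∈ s then t else u k) ∈ E := by
    intro u hu s
    rw [hE, Finset.mem_erase, mem_positiveWords] at hu ⊢
    refine ⟨fun hcon => ?_, fun k => ?_, hu.2.2.trans_le (Finset.sum_le_sum fun k _ => ?_)⟩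
    · rcases s.eq_empty_or_nonempty with rfl | ⟨k, hk⟩
      · exact hu.1 (by simpa using hcon)
      · have := congrFun hcon k
        rw [if_pos hk] at this
        exact hc this.symm
    · split_ifs
      exacts [ht0, hu.2.1 k]
    · split_ifs
      exacts [letterWeight_le hq _, le_rfl]
  have hiff : ∀ u ∈ E, ∀ s : Finset (Fin (n + 1)),
      (fun k => if k ∈ s then t else u k) ∈ C ↔ u ∈ C := by
    intro u hu s
    induction s using Finset.induction_on with
    | empty => simp
    | insert a s _ ih =>
      have hoff : ∀ k, k ≠ a →
          (if k ∈ insert a s then t else u k) = if k ∈ s then t else u k := fun k hk => by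
        simp [Finset.mem_insert, hk]
      rw [← ih]
      exact ⟨fun h => mem_of_eq_off hErot hrot hfirst a _ h _ (hmem u hu s) hoff,
        fun h => mem_of_eq_off hErot hrot hfirst a _ h _ (hmem u hu _)
          fun k hk => (hoff k hk).symm⟩
  have hiff' : ∀ u ∈ E, (fun _ => t) ∈ C ↔ u ∈ C := fun u hu => by
    simpa using hiff u hu Finset.univ
  obtain ⟨u, hu⟩ := hne
  exact Set.Subset.antisymm hCE fun v hv =>
    (hiff' v hv).1 ((hiff' u (hCE hu)).2 hu)

lemma const_mem_positiveWords {i : ℕ} (hi : 0 < i) (hiq : 2 * i < q) :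
    (fun _ => (i : ZMod q)) ∈ positiveWords q n := by
  rw [mem_positiveWords]
  refine ⟨fun _ => ?_, Finset.sum_pos (fun _ _ => ?_) Finset.univ_nonempty⟩
  · have := natCast_ne_natCast_of_lt (q := q) (i := i) (j := 0) (by omega) (by omega) (by omega)
    simpa using this
  · rw [letterWeight_natCast hiq]; omega

lemma sum_positiveWords_erase {i : ℕ} (hiq : 2 * i < q) :
    ∑ u ∈ (positiveWords q n).erase (fun _ => (i : ZMod q)), u 0
      = ∑ u ∈ positiveWords q n, u 0 - (i : ZMod q) := by
  rcases Nat.eq_zero_or_pos i with rfl | hi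
  · rw [Finset.erase_eq_of_notMem, Nat.cast_zero, sub_zero]
    intro h
    exact (mem_positiveWords.1 h).1 0 (by simp)
  · rw [Finset.sum_erase_eq_sub (const_mem_positiveWords hi hiq)]

/-- The words of positive weight, with at most one constant word left out, are the windows of
a negative orientable sequence without zeros. -/
theorem exists_isExtendable_of_isUnit (hq : 2 < q) (hn : 0 < n) {i : ℕ} (hi : i < (q - 1) / 2)
    (hunit : IsUnit (∑ u ∈ positiveWords q n, u 0 - (i : ZMod q))) :
    ∃ (m : ℕ) (S : ℤ → ZMod q), IsExtendable q (-1) (n + 1) m 0 S ∧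
      (positiveWords q n).card ≤ m + 1 := by
  have hc : (i : ZMod q) ≠ ((q - 1) / 2 : ℕ) :=
    natCast_ne_natCast_of_lt (by omega) (by omega) (by omega)
  set E := (positiveWords q n).erase fun _ => (i : ZMod q) with hE
  have hEne : E.Nonempty := ⟨fun _ => ((q - 1) / 2 : ℕ), Finset.mem_erase.2
    ⟨fun h => hc (congrFun h 0).symm, const_mem_positiveWords (by omega) (by omega)⟩⟩
  obtain ⟨S, hper, hmem, hwin, hsum⟩ := exists_sequence_of_connected E hEne
    (fun u => by simp only [hE, Finset.mem_erase, rotate_mem_positiveWords, Ne,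
      rotate_eq_const_iff])
    (positiveWords_erase_connected hq hc)
  have hpos : ∀ i : ℤ, 0 < ∑ k : Fin (n + 1), letterWeight q (S (i + (k : ℕ))) := fun i =>
    (mem_positiveWords.1 (Finset.mem_of_mem_erase (hmem i))).2
  have hne : ∀ i : ℤ, S i ≠ 0 := fun i => by
    simpa using (mem_positiveWords.1 (Finset.mem_of_mem_erase (hmem i))).1 0
  refine ⟨E.card, S, ⟨Finset.card_pos.2 hEne, hper, hwin, fun i j => ?_, fun i => ⟨0, le_rfl, ?_⟩,
    ?_, by omega, ?_⟩, ?_⟩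
  · by_contra! hcon
    have h1 : ∑ k : Fin (n + 1), letterWeight q (S (i + (k : ℕ)))
        = -∑ k : Fin (n + 1), letterWeight q (S (j - n + (k : ℕ))) := by
      rw [← Finset.sum_neg_distrib, ← Equiv.sum_comp Fin.revPerm]
      refine Finset.sum_congr rfl fun k _ => ?_
      rw [hcon _ (Fin.is_lt _), neg_one_mul, letterWeight_neg (hne _)]
      congr 3
      have := k.2
      simp only [Fin.revPerm_apply, Fin.val_rev]
      omega
    have := hpos i
    have := hpos (j - n)
    omega
  · exact hne _
  -- If `S i = -S (i + 1)` for all `i`, then consecutive windows have opposite weights.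
  · by_contra! hcon
    have h1 : ∑ k : Fin (n + 1), letterWeight q (S (0 + (k : ℕ)))
        = -∑ k : Fin (n + 1), letterWeight q (S (1 + (k : ℕ))) := by
      rw [← Finset.sum_neg_distrib]
      refine Finset.sum_congr rfl fun k _ => ?_
      rw [hcon _ (fun k hk => absurd hk (by omega)), neg_one_mul, letterWeight_neg (hne _)]
      congr 3
      push_cast; ring
    have := hpos 0
    have := hpos 1
    omega
  · have := hsum (fun x : ZMod q => x)
    rw [this, sum_positiveWords_erase (by omega)]
    exact hunit
  · have : (positiveWords q n).card - 1 ≤ E.card := Finset.pred_card_le_card_erase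
    omega

end

/-! ### The number of words of positive weight -/

section

variable {q n : ℕ} [NeZero q]

/-- The words of length `n + 1` without the letter `0` whose weight is zero. -/
def weightlessWords (q n : ℕ) [NeZero q] : Finset (Fin (n + 1) → ZMod q) :=
  Finset.univ.filter fun u => (∀ k, u k ≠ 0) ∧ ∑ k, letterWeight q (u k) = 0

lemma mem_weightlessWords {u : Fin (n + 1) → ZMod q} :
    u ∈ weightlessWords q n ↔ (∀ k, u k ≠ 0) ∧ ∑ k, letterWeight q (u k) = 0 := by
  simp [weightlessWords]

lemma sum_letterWeight_neg {u : Fin (n + 1) → ZMod q} (hu : ∀ k, u k ≠ 0) :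
    ∑ k, letterWeight q ((-u) k) = -∑ k, letterWeight q (u k) := by
  rw [← Finset.sum_neg_distrib]
  exact Finset.sum_congr rfl fun k _ => letterWeight_neg (hu k)

/-- Negation exchanges the words of positive and of negative weight. -/
lemma two_mul_card_positiveWords :
    2 * (positiveWords q n).card + (weightlessWords q n).card = (q - 1) ^ (n + 1) := by
  classical
  have hall : (Fintype.piFinset fun _ : Fin (n + 1) => (Finset.univ : Finset (ZMod q)).erase 0).card
      = (q - 1) ^ (n + 1) := by
    simp [Fintype.card_piFinset, Finset.card_erase_of_mem, ZMod.card]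
  have hneg : ((positiveWords q n).image fun u => -u).card = (positiveWords q n).card :=
    Finset.card_image_of_injective _ neg_injective
  have hmemneg : ∀ u : Fin (n + 1) → ZMod q, u ∈ (positiveWords q n).image (fun u => -u) ↔
      (∀ k, u k ≠ 0) ∧ ∑ k, letterWeight q (u k) < 0 := by
    intro u
    rw [Finset.mem_image]
    constructor
    · rintro ⟨v, hv, rfl⟩
      rw [mem_positiveWords] at hv
      rw [sum_letterWeight_neg hv.1]
      exact ⟨fun k => neg_ne_zero.2 (hv.1 k), by omega⟩
    · rintro ⟨h1, h2⟩
      refine ⟨-u, mem_positiveWords.2 ⟨fun k => neg_ne_zero.2 (h1 k), ?_⟩, neg_neg u⟩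
      rw [sum_letterWeight_neg h1]; omega
  have hd1 : Disjoint (positiveWords q n) ((positiveWords q n).image fun u => -u) := by
    rw [Finset.disjoint_left]
    intro u h1 h2
    have := (mem_positiveWords.1 h1).2
    have := ((hmemneg u).1 h2).2
    omega
  have hd2 : Disjoint (positiveWords q n ∪ (positiveWords q n).image fun u => -u)
      (weightlessWords q n) := by
    rw [Finset.disjoint_left]
    intro u h1 h2
    have h3 := (mem_weightlessWords.1 h2).2
    rcases Finset.mem_union.1 h1 with h1 | h1
    · have := (mem_positiveWords.1 h1).2
      omega
    · have := ((hmemneg u).1 h1).2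
      omega
  have hunion : (positiveWords q n ∪ (positiveWords q n).image fun u => -u) ∪ weightlessWords q n
      = Fintype.piFinset fun _ : Fin (n + 1) => (Finset.univ : Finset (ZMod q)).erase 0 := by
    ext u
    rw [Finset.mem_union, Finset.mem_union, hmemneg, mem_positiveWords, mem_weightlessWords]
    simp only [Fintype.mem_piFinset, Finset.mem_erase, Finset.mem_univ, and_true]
    rw [← and_or_left, ← and_or_left, and_iff_left_iff_imp]
    intro _
    omega
  rw [← hall, ← hunion, Finset.card_union_of_disjoint hd2, Finset.card_union_of_disjoint hd1, hneg]
  ring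

lemma card_weightlessWords_one_le : (weightlessWords q 1).card ≤ q - 1 := by
  have h : ((Finset.univ : Finset (ZMod q)).erase 0).card = q - 1 := by
    simp [Finset.card_erase_of_mem, ZMod.card]
  rw [← h]
  refine Finset.card_le_card_of_injOn (fun u => u 0) (fun u hu => ?_) fun u hu v hv huv => ?_
  · simpa using (mem_weightlessWords.1 hu).1 0
  · have hu' := mem_weightlessWords.1 hu
    have hv' := mem_weightlessWords.1 hv
    have h1 := hu'.2
    have h2 := hv'.2
    rw [Fin.sum_univ_two] at h1 h2
    have huv' : u 0 = v 0 := huv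
    rw [huv'] at h1
    have h3 := letterWeight_injOn (hu'.1 1) (hv'.1 1) (by omega)
    funext k
    fin_cases k
    exacts [huv', h3]

/-- Three nonzero letters whose weights add up to zero are `q / 2`, `i` and `-i`. -/
lemma letterWeight_add_add_eq_zero {x y z : ZMod q} (hx : x ≠ 0) (hy : y ≠ 0) (hz : z ≠ 0)
    (h : letterWeight q x + letterWeight q y + letterWeight q z = 0) :
    (2 * x.val = q ∧ z = -y) ∨ (2 * y.val = q ∧ z = -x) ∨ (2 * z.val = q ∧ y = -x) := by
  have key : ∀ x y z : ZMod q, y ≠ 0 → z ≠ 0 → 2 * x.val = q →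
      letterWeight q x + letterWeight q y + letterWeight q z = 0 → z = -y := by
    intro x y z hy hz hx h
    have h0 : letterWeight q x = 0 := by
      rw [letterWeight, if_neg (by omega), if_pos hx]
    refine letterWeight_injOn hz (neg_ne_zero.2 hy) ?_
    rw [letterWeight_neg hy]; omega
  have hx' := ZMod.val_lt x
  have hy' := ZMod.val_lt y
  have hz' := ZMod.val_lt z
  have hx0 := (ZMod.val_ne_zero x).2 hx
  have hy0 := (ZMod.val_ne_zero y).2 hy
  have hz0 := (ZMod.val_ne_zero z).2 hz
  by_cases h1 : 2 * x.val = q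
  · exact Or.inl ⟨h1, key x y z hy hz h1 h⟩
  by_cases h2 : 2 * y.val = q
  · exact Or.inr (Or.inl ⟨h2, key y x z hx hz h2 (by omega)⟩)
  by_cases h3 : 2 * z.val = q
  · exact Or.inr (Or.inr ⟨h3, key z x y hx hy h3 (by omega)⟩)
  exfalso
  unfold letterWeight at h
  split_ifs at h <;> omega

lemma weightlessWords_two_eq_empty (hq : Odd q) : weightlessWords q 2 = ∅ := by
  obtain ⟨c, hc⟩ := hq
  refine Finset.eq_empty_of_forall_notMem fun u hu => ?_
  obtain ⟨h1, h2⟩ := mem_weightlessWords.1 hu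
  rw [Fin.sum_univ_three] at h2
  rcases letterWeight_add_add_eq_zero (h1 0) (h1 1) (h1 2) h2 with ⟨h, -⟩ | ⟨h, -⟩ | ⟨h, -⟩ <;>
    omega

lemma card_weightlessWords_two_le (hq : 2 < q) (heven : Even q) :
    (weightlessWords q 2).card ≤ 3 * (q - 2) + 1 := by
  classical
  obtain ⟨c, hc⟩ := heven
  set d : ZMod q := (c : ZMod q) with hd
  have hd0 : d ≠ 0 := by
    have := natCast_ne_natCast_of_lt (q := q) (i := c) (j := 0) (by omega) (by omega) (by omega)
    simpa using this
  have hdd : -d = d := by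
    rw [neg_eq_iff_add_eq_zero, hd, ← Nat.cast_add, ← hc, ZMod.natCast_self]
  have hval : ∀ x : ZMod q, 2 * x.val = q → x = d := fun x hx => by
    rw [← ZMod.natCast_zmod_val x, hd]
    congr 1; omega
  -- The word `d d d` arises in all of the three ways and is counted once.
  set A := ((Finset.univ : Finset (ZMod q)).erase 0).erase d with hA
  have hAcard : A.card = q - 2 := by
    rw [hA, Finset.card_erase_of_mem (by simpa using hd0), Finset.card_erase_of_mem (by simp),
      Finset.card_univ, ZMod.card]
    omega
  have hsub : weightlessWords q 2 ⊆ insert ![d, d, d] ((A.image fun x => ![d, x, -x]) ∪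
      (A.image fun x => ![x, d, -x]) ∪ (A.image fun x => ![x, -x, d])) := by
    intro u hu
    obtain ⟨h1, h2⟩ := mem_weightlessWords.1 hu
    rw [Fin.sum_univ_three] at h2
    have heq : ∀ x y z, u 0 = x → u 1 = y → u 2 = z → u = ![x, y, z] := by
      rintro _ _ _ rfl rfl rfl
      funext k
      fin_cases k <;> rfl
    simp only [Finset.mem_insert, Finset.mem_union, Finset.mem_image, hA, Finset.mem_erase,
      Finset.mem_univ, and_true]
    rcases letterWeight_add_add_eq_zero (h1 0) (h1 1) (h1 2) h2 with ⟨h, h'⟩ | ⟨h, h'⟩ | ⟨h, h'⟩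
    · by_cases h3 : u 1 = d
      · exact Or.inl (heq _ _ _ (hval _ h) h3 (by rw [h', h3, hdd]))
      · right; left; left
        exact ⟨u 1, ⟨h3, h1 1⟩, (heq _ _ _ (hval _ h) rfl h').symm⟩
    · by_cases h3 : u 0 = d
      · exact Or.inl (heq _ _ _ h3 (hval _ h) (by rw [h', h3, hdd]))
      · right; left; right
        exact ⟨u 0, ⟨h3, h1 0⟩, (heq _ _ _ rfl (hval _ h) h').symm⟩
    · by_cases h3 : u 0 = d
      · exact Or.inl (heq _ _ _ h3 (by rw [h', h3, hdd]) (hval _ h))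
      · right; right
        exact ⟨u 0, ⟨h3, h1 0⟩, (heq _ _ _ rfl h' (hval _ h)).symm⟩
  have h1 := Finset.card_le_card hsub
  have h2 := Finset.card_insert_le ![d, d, d] ((A.image fun x => ![d, x, -x]) ∪
      (A.image fun x => ![x, d, -x]) ∪ (A.image fun x => ![x, -x, d]))
  have h3 := Finset.card_union_le ((A.image fun x => ![d, x, -x]) ∪
      (A.image fun x => ![x, d, -x])) (A.image fun x => ![x, -x, d])
  have h4 := Finset.card_union_le (A.image fun x => ![d, x, -x]) (A.image fun x => ![x, d, -x])
  have h5 : (A.image fun x => ![d, x, -x]).card ≤ A.card := Finset.card_image_le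
  have h6 : (A.image fun x => ![x, d, -x]).card ≤ A.card := Finset.card_image_le
  have h7 : (A.image fun x => ![x, -x, d]).card ≤ A.card := Finset.card_image_le
  omega

end

/-! ### Reaching a unit -/

lemma coprime_of_odd_of_add_two {h x : ℕ} (hh : Odd h) (hx : x = h + 2 ∨ x + 2 = h) :
    Nat.Coprime x (2 * h) := by
  have h2 : Nat.Coprime h 2 := Nat.coprime_two_right.2 hh
  refine Nat.Coprime.mul_right ?_ ?_
  · rw [Nat.coprime_two_right]
    obtain ⟨c, rfl⟩ := hh
    rcases hx with rfl | hx
    · exact ⟨c + 1, by ring⟩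
    · exact ⟨c - 1, by omega⟩
  · rcases hx with rfl | rfl
    · simpa using h2.symm
    · simpa using h2.symm

lemma coprime_of_even_of_add_one {h x : ℕ} (hh : Even h) (hx : x = h + 1 ∨ x + 1 = h) :
    Nat.Coprime x (2 * h) := by
  refine Nat.Coprime.mul_right ?_ ?_
  · rw [Nat.coprime_two_right]
    obtain ⟨c, rfl⟩ := hh
    rcases hx with rfl | hx
    · exact ⟨c, by ring⟩
    · exact ⟨c - 1, by omega⟩
  · rcases hx with rfl | rfl
    · simp
    · simp

/-- Among any `(q - 1) / 2` consecutive residues modulo `q` there is a unit, if `q ≥ 5` and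
`q ≠ 6`. The units used are `1`, `-1` and those next to `q / 2`. -/
lemma exists_isUnit_sub {q : ℕ} (hq : 5 ≤ q) (hq6 : q ≠ 6) (y : ZMod q) :
    ∃ i : ℕ, i < (q - 1) / 2 ∧ IsUnit (y - (i : ZMod q)) := by
  have : NeZero q := ⟨by omega⟩
  have hy := ZMod.val_lt y
  have key : ∀ d : ℕ, d ≤ y.val → y.val - d < (q - 1) / 2 → Nat.Coprime d q →
      ∃ i : ℕ, i < (q - 1) / 2 ∧ IsUnit (y - (i : ZMod q)) := by
    intro d h1 h2 h3
    refine ⟨y.val - d, h2, ?_⟩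
    rw [Nat.cast_sub h1, ZMod.natCast_zmod_val, sub_sub_cancel]
    exact (ZMod.isUnit_iff_coprime d q).2 h3
  by_cases h0 : y.val = 0
  · refine ⟨1, by omega, ?_⟩
    rw [(ZMod.val_eq_zero y).1 h0]
    simp
  by_cases h1 : y.val ≤ (q - 1) / 2
  · exact key 1 (by omega) (by omega) (Nat.coprime_one_left q)
  rcases Nat.even_or_odd' q with ⟨h, rfl | rfl⟩
  · rcases Nat.even_or_odd h with hh | hh
    · by_cases h2 : y.val = h
      · exact key (h - 1) (by omega) (by omega) (coprime_of_even_of_add_one hh (by omega))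
      · exact key (h + 1) (by omega) (by omega) (coprime_of_even_of_add_one hh (by omega))
    · have h5 : 5 ≤ h := by
        obtain ⟨c, rfl⟩ := hh
        omega
      by_cases h2 : y.val ≤ h + 1
      · exact key (h - 2) (by omega) (by omega) (coprime_of_odd_of_add_two hh (by omega))
      · exact key (h + 2) (by omega) (by omega) (coprime_of_odd_of_add_two hh (by omega))
  · refine key (h + 1) (by omega) (by omega) ?_
    rw [show 2 * h + 1 = (h + 1) + h by ring]
    simp

/-! ### The initial sequences -/

/-- A bi-infinite periodic sequence given by one period. -/
lemma isExtendable_of_zmod {q M : ℕ} [NeZero M] (f : ZMod M → ZMod q)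
    (hwin : ∀ i j, f i = f j → f (i + 1) = f (j + 1) → i = j)
    (hrev : ∀ i j, f i = -f (j + 1) → f (i + 1) ≠ -f j) (hne : ∀ i, f i ≠ 0)
    (hsum : IsUnit (∑ i, f i)) :
    IsExtendable q (-1) 2 M 0 fun i : ℤ => f i where
  pos := NeZero.pos M
  periodic := fun i => by simp
  window_unique := fun i j hij => by
    rw [← ZMod.intCast_eq_intCast_iff]
    refine hwin _ _ (by simpa using hij 0 (by omega)) ?_
    have := hij 1 (by omega)
    push_cast at this
    exact this
  ne_reverse := fun i j => by
    by_contra! hij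
    have h0 := hij 0 (by omega)
    have h1 := hij 1 (by omega)
    push_cast at h0 h1
    exact hrev i (j - 1) (by simpa using h0) (by simpa using h1)
  run_le := fun i => ⟨0, le_rfl, hne _⟩
  exists_run := ⟨0, fun k hk => absurd hk (by omega), fun h => by
    have h' : f 0 = -f (0 + 1) := by simpa using h
    exact hrev 0 0 h' (by rw [h', neg_neg])⟩
  le_order := le_rfl
  isUnit_weight := by
    convert hsum
    refine Finset.sum_bij (fun i _ => ((i : ℤ) : ZMod M)) (fun _ _ => Finset.mem_univ _)
      (fun i hi j hj hij => ?_) (fun x _ => ⟨x.val, Finset.mem_range.2 (ZMod.val_lt x), ?_⟩)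
      (fun _ _ => rfl)
    · rw [ZMod.intCast_eq_intCast_iff, Int.natCast_modEq_iff] at hij
      exact hij.eq_of_lt_of_lt (Finset.mem_range.1 hi) (Finset.mem_range.1 hj)
    · simp

lemma isUnit_sum_positiveWords_three_one : IsUnit (∑ u ∈ positiveWords 3 1, u 0) := by
  have : ∑ u ∈ positiveWords 3 1, u 0 = 1 := by decide +kernel
  rw [this]; exact isUnit_one

lemma isUnit_sum_positiveWords_three_two : IsUnit (∑ u ∈ positiveWords 3 2, u 0) := by
  have : ∑ u ∈ positiveWords 3 2, u 0 = 2 := by decide +kernel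
  rw [this]; exact ⟨⟨2, 2, rfl, rfl⟩, rfl⟩

lemma isUnit_sum_positiveWords_four_two : IsUnit (∑ u ∈ positiveWords 4 2, u 0) := by
  have : ∑ u ∈ positiveWords 4 2, u 0 = 3 := by decide +kernel
  rw [this]; exact ⟨⟨3, 3, rfl, rfl⟩, rfl⟩

lemma isUnit_sum_positiveWords_six_two : IsUnit (∑ u ∈ positiveWords 6 2, u 0) := by
  have : ∑ u ∈ positiveWords 6 2, u 0 = 5 := by decide +kernel
  rw [this]; exact ⟨⟨5, 5, rfl, rfl⟩, rfl⟩

/-- One period of a negative orientable sequence of order `2` over `ℤ_4`. -/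
def quaternaryPeriod : ZMod 2 → ZMod 4 := ![1, 2]

/-- One period of a negative orientable sequence of order `2` over `ℤ_6`. -/
def senaryPeriod : ZMod 8 → ZMod 6 := ![1, 2, 5, 2, 3, 1, 3, 2]

lemma exists_isExtendable_two {q : ℕ} (hq : 2 < q) :
    ∃ (m : ℕ) (S : ℤ → ZMod q), IsExtendable q (-1) 2 m 0 S ∧ m₂ q ≤ m := by
  -- For `q = 4` and `q = 6`, omitting the word `i i` with `i < (q - 1) / 2` does not make the
  -- weight a unit.
  by_cases h4 : q = 4
  · subst h4
    refine ⟨2, _, isExtendable_of_zmod (M := 2) quaternaryPeriod (by decide) (by decide)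
      (by decide) ?_, by norm_num [m₂]⟩
    exact ⟨⟨3, 3, rfl, rfl⟩, rfl⟩
  by_cases h6 : q = 6
  · subst h6
    refine ⟨8, _, isExtendable_of_zmod (M := 8) senaryPeriod (by decide) (by decide)
      (by decide) ?_, by norm_num [m₂]⟩
    exact ⟨⟨1, 1, rfl, rfl⟩, rfl⟩
  have : NeZero q := ⟨by omega⟩
  obtain ⟨i, hi, hunit⟩ : ∃ i : ℕ, i < (q - 1) / 2 ∧
      IsUnit (∑ u ∈ positiveWords q 1, u 0 - (i : ZMod q)) := by
    by_cases h3 : q = 3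
    · subst h3
      exact ⟨0, by norm_num, by simpa using isUnit_sum_positiveWords_three_one⟩
    · exact exists_isUnit_sub (by omega) h6 _
  obtain ⟨m, S, hS, hm⟩ := exists_isExtendable_of_isUnit hq one_pos hi hunit
  refine ⟨m, S, hS, ?_⟩
  have h1 := two_mul_card_positiveWords (q := q) (n := 1)
  have h2 := card_weightlessWords_one_le (q := q)
  have h3 : (q - 1) ^ (1 + 1) ≤ 2 * (m + 1) + (q - 1) := by omega
  have h4 : ((q : ℚ) - 1) ^ 2 ≤ 2 * (m + 1) + (q - 1) := by
    have := (Nat.cast_le (α := ℚ)).2 h3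
    push_cast [Nat.cast_sub (by omega : 1 ≤ q)] at this
    exact this
  rw [m₂, if_neg h6]
  linarith

lemma exists_isExtendable_three {q : ℕ} (hq : 2 < q) :
    ∃ (m : ℕ) (S : ℤ → ZMod q), IsExtendable q (-1) 3 m 0 S ∧ m₃ q ≤ m := by
  have : NeZero q := ⟨by omega⟩
  obtain ⟨i, hi, hunit⟩ : ∃ i : ℕ, i < (q - 1) / 2 ∧
      IsUnit (∑ u ∈ positiveWords q 2, u 0 - (i : ZMod q)) := by
    by_cases h3 : q = 3
    · subst h3
      exact ⟨0, by norm_num, by simpa using isUnit_sum_positiveWords_three_two⟩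
    by_cases h4 : q = 4
    · subst h4
      exact ⟨0, by norm_num, by simpa using isUnit_sum_positiveWords_four_two⟩
    by_cases h6 : q = 6
    · subst h6
      exact ⟨0, by norm_num, by simpa using isUnit_sum_positiveWords_six_two⟩
    exact exists_isUnit_sub (by omega) h6 _
  obtain ⟨m, S, hS, hm⟩ := exists_isExtendable_of_isUnit hq two_pos hi hunit
  refine ⟨m, S, hS, ?_⟩
  have h1 := two_mul_card_positiveWords (q := q) (n := 2)
  have hq' : (2 : ℚ) < q := by exact_mod_cast hq
  rcases Nat.even_or_odd q with he | ho
  · have h2 := card_weightlessWords_two_le hq he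
    have h3 : (q - 1) ^ (2 + 1) ≤ 2 * (m + 1) + (3 * (q - 2) + 1) := by omega
    have h4 : ((q : ℚ) - 1) ^ 3 ≤ 2 * (m + 1) + (3 * (q - 2) + 1) := by
      have := (Nat.cast_le (α := ℚ)).2 h3
      push_cast [Nat.cast_sub (by omega : 1 ≤ q), Nat.cast_sub (by omega : 2 ≤ q)] at this
      exact this
    have h5 : (4 : ℚ) ≤ q := by
      obtain ⟨c, hc⟩ := he
      exact_mod_cast (by omega : 4 ≤ q)
    -- This is `3 (q - 2) + 1 ≤ (3 q² - 6 q + 4) / 4`.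
    have h6 : 0 ≤ ((q : ℚ) - 2) * ((q : ℚ) - 4) := mul_nonneg (by linarith) (by linarith)
    rw [m₃, if_neg (Nat.not_odd_iff_even.2 he)]
    split_ifs <;> linarith
  · have h2 := weightlessWords_two_eq_empty ho
    rw [h2, Finset.card_empty] at h1
    have h3 : (q - 1) ^ (2 + 1) ≤ 2 * (m + 1) := by omega
    have h4 : ((q : ℚ) - 1) ^ 3 ≤ 2 * (m + 1) := by
      have := (Nat.cast_le (α := ℚ)).2 h3
      push_cast [Nat.cast_sub (by omega : 1 ≤ q)] at this
      exact this
    rw [m₃, if_pos ho]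
    linarith

end Orientable

theorem mainTheorem4 (q : ℕ) (hq : 2 < q) (s : ℕ) :
    (∃ (m : ℕ) (S : ℤ → ZMod q),
      Orientable.IsGoodOrientable q (2 * s + 3) m S ∧
        (q : ℚ) ^ (2 * s + 1) * Orientable.m₂ q
          + ((q : ℚ) ^ (2 * s + 1) - 1) / ((q : ℚ) - 1) ≤ (m : ℚ)) ∧
    (∃ (m : ℕ) (S : ℤ → ZMod q),
      Orientable.IsGoodOrientable q (2 * s + 4) m S ∧
        (q : ℚ) ^ (2 * s + 1) * Orientable.m₃ q
          + ((q : ℚ) ^ (2 * s + 1) - 1) / ((q : ℚ) - 1) ≤ (m : ℚ)) := by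
  have hpow : (0 : ℚ) ≤ (q : ℚ) ^ (2 * s + 1) := by positivity
  constructor
  · obtain ⟨m, T, hT, hm⟩ := Orientable.exists_isExtendable_two hq
    obtain ⟨M, r, S, hS, hM⟩ := hT.exists_iterate hq s
    rw [show 2 + (2 * s + 1) = 2 * s + 3 by ring] at hS
    refine ⟨M, S, hS.isGoodOrientable (by omega), ?_⟩
    rw [← hM]
    gcongr
  · obtain ⟨m, T, hT, hm⟩ := Orientable.exists_isExtendable_three hq
    obtain ⟨M, r, S, hS, hM⟩ := hT.exists_iterate hq s
    rw [show 3 + (2 * s + 1) = 2 * s + 4 by ring] at hS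
    refine ⟨M, S, hS.isGoodOrientable (by omega), ?_⟩
    rw [← hM]
    gcongr
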